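/- For a prime $p$ let $p^+$ be the least prime greater than $p$, let $p^{+(0)}=p$ and $p^{+(j+1)}=(p^{+(j)})^+$, and let $g(p)=p^+-p$. For $t\ge 1$ put $$\mathbf G^{(t)}(p)=\bigl(g(p),g(p^{+}),\dots,g(p^{+(t-1)})\bigr)\in\mathbb N^t .$$ For real $X\ge 2$ let $P$ be uniformly distributed on the (nonempty, finite) set of primes in $[X,2X]$, and put $\mathbf G^{(t)}_X=\mathbf G^{(t)}(P)$. Theorem. For every integer $t\ge 1$ there are constants $C_t>0$, $A_t\in\mathbb Z_{\ge0}$ and $X_t$, depending only on $t$, such that for all real $X\ge X_t$ and all finite sets $\mathcal S\subseteq\mathbb N^t$, $$\Pr\bigl[\mathbf G^{(t)}_X\in\mathcal S\bigr]\le C_t\,\frac{|\mathcal S|\,(\log\log(3X))^{A_t}}{(\log X)^t}.$$ -/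

import Mathlib

noncomputable section

namespace PrimeGaps

/-- The set of primes in the dyadic interval `[X, 2X]`, for real `X`. -/
def dyadicPrimes (X : ℝ) : Set ℕ := {p : ℕ | p.Prime ∧ X ≤ (p : ℝ) ∧ (p : ℝ) ≤ 2 * X}

theorem exists_prime_gt (n : ℕ) : ∃ q : ℕ, n < q ∧ q.Prime := by
  obtain ⟨q, hq, hp⟩ := Nat.exists_infinite_primes (n + 1)
  exact ⟨q, hq, hp⟩

open Classical in
/-- The least prime strictly greater than `n`. -/
def nextPrime (n : ℕ) : ℕ := Nat.find (exists_prime_gt n)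

/-- The gap from `p` to the next prime (no truncation occurs, since `p < nextPrime p`). -/
def gap (p : ℕ) : ℕ := nextPrime p - p

/-- The vector of `t` consecutive gaps starting at `p`:
its `j`-th entry (`0 ≤ j < t`) is the gap after the `j`-th successor prime of `p`. -/
def gapVector (t : ℕ) (p : ℕ) : Fin t → ℕ := fun j => gap (nextPrime^[(j : ℕ)] p)

/-- The law of the gap vector `gapVector t P` for `P` uniformly distributed on the primes in
`[X, 2X]` (a finite set, and a nonempty one for `1 ≤ X`). -/
def gapVectorLaw (t : ℕ) (X : ℝ) : MeasureTheory.Measure (Fin t → ℕ) :=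
  (ProbabilityTheory.uniformOn (dyadicPrimes X)).map (gapVector t)

end PrimeGaps

end

/-! Fix a gap vector `v`. If some prime `p` in `[X, 2X]` has gap vector `v`, the partial sums of `v`
are `t + 1` distinct offsets `h` (including `0`), of size `O(X)` by Bertrand, such that every prime
with gap vector `v` makes all `p + h` prime. An upper-bound sieve, uniform in the offsets, allows at
most `X / (log X)^(t+1)` such `p`, up to powers of `log log X`. Summing over the vectors of `S` and
dividing by the number of primes in `[X, 2X]`, at least of order `X / log X`, leaves `(log X)^t` in
the denominator.

Since powers of `log log X` are free, Brun's pure sieve suffices (`card_sieved_translates_le`). It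
sifts by primes up to `exp (L / (c log L))` with `L = log X`, omitting those dividing `tupleModulus
H`, modulo which offsets may collide. That modulus has logarithm `O(L)`, so by
`sum_inv_primeFactors_le` the omission costs only a power of `log L`, and no singular series is
needed. The other inputs are Mertens-type bounds, from Chebyshev's upper bound and an Euler product,
and a Chebyshev lower bound from central binomial coefficients. -/

namespace PrimeGaps

open Finset

/-! ### Brun's pure sieve -/

/-- **Bonferroni's inequality**: truncating the alternating sum over subsets at an even level
gives an upper bound for the indicator of the empty set. -/
theorem bonferroni_indicator {ι : Type*} (U : Finset ι) {r : ℕ} (hr : Even r) [Decidable (U = ∅)] :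
    (if U = ∅ then 1 else 0 : ℤ) ≤ ∑ T ∈ U.powerset with #T ≤ r, (-1) ^ #T := by
  have key : ∑ T ∈ U.powerset with #T ≤ r, (-1 : ℤ) ^ #T
      = ∑ j ∈ range (r + 1), (-1) ^ j * ((#U).choose j : ℤ) := by
    rw [← sum_fiberwise_of_maps_to (s := {T ∈ U.powerset | #T ≤ r}) (t := range (r + 1))
      (g := fun T => #T) (by intro T hT; simp at hT ⊢; omega)]
    refine sum_congr rfl fun j hj => ?_
    have : {T ∈ {T ∈ U.powerset | #T ≤ r} | #T = j} = powersetCard j U := by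
      ext T; simp [mem_powersetCard] at hj ⊢; intro _; omega
    rw [this, sum_congr rfl (g := fun _ => (-1 : ℤ) ^ j)
      (fun T hT => by rw [(mem_powersetCard.1 hT).2]), sum_const, card_powersetCard]
    simp [mul_comm]
  rw [key]
  by_cases hU : U = ∅
  · subst hU
    rw [sum_eq_single 0] <;> simp
    intro b _ hb; exact Nat.choose_eq_zero_of_lt (Nat.pos_of_ne_zero hb)
  · have h0 : #U ≠ 0 := by simpa using hU
    obtain ⟨n, hn⟩ := Nat.exists_eq_succ_of_ne_zero h0
    rw [if_neg hU, hn, Nat.succ_eq_add_one, Int.alternating_sum_range_choose_eq_choose,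
      hr.neg_one_pow]
    positivity

/-- Brun's pure sieve in abstract form. -/
theorem brun_pure_sieve {α : Type*} (I : Finset α) (P : Finset ℕ) (b : ℕ → α → Prop)
    [∀ p n, Decidable (b p n)] {r : ℕ} (hr : Even r) (M : ℝ) (hM : 0 ≤ M) (g : ℕ → ℝ)
    (hg : ∀ p ∈ P, 0 ≤ g p) (k : ℝ)
    (hcount : ∀ T ⊆ P, |(#{n ∈ I | ∀ p ∈ T, b p n} : ℝ) - M * ∏ p ∈ T, g p| ≤ k ^ #T) :
    (#{n ∈ I | ∀ p ∈ P, ¬ b p n} : ℝ) ≤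
      M * (∏ p ∈ P, (1 - g p) + Real.exp (-r) * ∏ p ∈ P, (1 + Real.exp 1 * g p))
        + ∑ T ∈ P.powerset with #T ≤ r, k ^ #T := by
  classical
  have h1 : (#{n ∈ I | ∀ p ∈ P, ¬ b p n} : ℝ) ≤
      ∑ T ∈ P.powerset with #T ≤ r, (-1 : ℝ) ^ #T * #{n ∈ I | ∀ p ∈ T, b p n} := by
    have h2 : (#{n ∈ I | ∀ p ∈ P, ¬ b p n} : ℤ) ≤
        ∑ n ∈ I, ∑ T ∈ ({p ∈ P | b p n}).powerset with #T ≤ r, (-1 : ℤ) ^ #T := by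
      rw [card_filter]
      push_cast
      refine sum_le_sum fun n _ => ?_
      refine le_trans (le_of_eq ?_) (bonferroni_indicator {p ∈ P | b p n} hr)
      simp [filter_eq_empty_iff]
    have h3 : ∑ n ∈ I, ∑ T ∈ ({p ∈ P | b p n}).powerset with #T ≤ r, (-1 : ℤ) ^ #T
        = ∑ T ∈ P.powerset with #T ≤ r, (-1 : ℤ) ^ #T * #{n ∈ I | ∀ p ∈ T, b p n} := by
      have : ∀ n, {T ∈ ({p ∈ P | b p n}).powerset | #T ≤ r}
          = {T ∈ {T ∈ P.powerset | #T ≤ r} | ∀ p ∈ T, b p n} := by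
        intro n; ext T
        simp only [mem_filter, mem_powerset, subset_iff]
        grind
      simp_rw [this, sum_filter (s := {T ∈ P.powerset | #T ≤ r}), card_filter]
      rw [sum_comm]
      refine sum_congr rfl fun T _ => ?_
      push_cast
      rw [mul_sum]
      simp
    rw [h3] at h2
    exact_mod_cast h2
  have h4 : ∑ T ∈ P.powerset with #T ≤ r, (-1 : ℝ) ^ #T * #{n ∈ I | ∀ p ∈ T, b p n} ≤
      M * (∑ T ∈ P.powerset with #T ≤ r, ∏ p ∈ T, (-g p))
        + ∑ T ∈ P.powerset with #T ≤ r, k ^ #T := by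
    rw [mul_sum, ← sum_add_distrib]
    refine sum_le_sum fun T hT => ?_
    have h5 := abs_le.1 (hcount T (mem_powerset.1 (mem_filter.1 hT).1))
    rw [prod_neg]
    rcases neg_one_pow_eq_or ℝ #T with h | h <;> rw [h] <;> linarith [h5.1, h5.2]
  -- Rankin's trick: `exp (#T - r) ≥ 1` on the discarded sets, so completing the sum to a full
  -- product costs at most the product with weights `e * g p`, scaled by `exp (-r)`.
  have h6 : ∑ T ∈ P.powerset with #T ≤ r, ∏ p ∈ T, (-g p) ≤
      ∏ p ∈ P, (1 - g p) + Real.exp (-r) * ∏ p ∈ P, (1 + Real.exp 1 * g p) := by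
    simp_rw [sub_eq_add_neg]
    rw [prod_one_add, prod_one_add, mul_sum,
      ← sum_filter_add_sum_filter_not P.powerset (fun T => #T ≤ r) (fun T => ∏ p ∈ T, (-g p)),
      add_assoc]
    refine le_add_of_nonneg_right ?_
    have h7 : ∑ T ∈ P.powerset with ¬ #T ≤ r, Real.exp (-r) * ∏ p ∈ T, (Real.exp 1 * g p)
        ≤ ∑ T ∈ P.powerset, Real.exp (-r) * ∏ p ∈ T, (Real.exp 1 * g p) := by
      refine sum_le_sum_of_subset_of_nonneg (filter_subset _ _) fun T hT _ => ?_
      have := fun p hp => hg p (mem_powerset.1 hT hp)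
      exact mul_nonneg (Real.exp_pos _).le
        (prod_nonneg fun p hp => mul_nonneg (Real.exp_pos _).le (this p hp))
    refine le_trans ?_ (add_le_add (le_refl _) h7)
    rw [← sum_add_distrib]
    refine sum_nonneg fun T hT => ?_
    have hT := mem_filter.1 hT
    have h8 : 0 ≤ ∏ p ∈ T, g p := prod_nonneg fun p hp => hg p (mem_powerset.1 hT.1 hp)
    rw [prod_neg, prod_mul_distrib, prod_const, ← mul_assoc, ← Real.exp_nat_mul, ← Real.exp_add,
      ← add_mul]
    refine mul_nonneg ?_ h8
    have h9 : (1 : ℝ) ≤ Real.exp (-r + #T * 1) := by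
      refine Real.one_le_exp ?_
      have : (r : ℝ) ≤ #T := by exact_mod_cast (not_le.1 hT.2).le
      linarith
    rcases neg_one_pow_eq_or ℝ #T with h | h <;> rw [h] <;> linarith
  refine h1.trans (h4.trans ?_)
  linarith [mul_le_mul_of_nonneg_left h6 hM]

theorem sum_pow_card_le (P : Finset ℕ) (r : ℕ) {k : ℝ} (hk : 0 ≤ k) :
    ∑ T ∈ P.powerset with #T ≤ r, k ^ #T ≤ (1 + k * #P) ^ r := by
  have key : ∑ T ∈ P.powerset with #T ≤ r, k ^ #T
      = ∑ j ∈ range (r + 1), k ^ j * ((#P).choose j : ℝ) := by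
    rw [← sum_fiberwise_of_maps_to (s := {T ∈ P.powerset | #T ≤ r}) (t := range (r + 1))
      (g := fun T => #T) (by intro T hT; simp at hT ⊢; omega)]
    refine sum_congr rfl fun j hj => ?_
    have : {T ∈ {T ∈ P.powerset | #T ≤ r} | #T = j} = powersetCard j P := by
      ext T; simp [mem_powersetCard] at hj ⊢; intro _; omega
    rw [this, sum_congr rfl (g := fun _ => k ^ j)
      (fun T hT => by rw [(mem_powersetCard.1 hT).2]), sum_const, card_powersetCard]
    simp [mul_comm]
  rw [key, add_comm (1 : ℝ), add_pow]
  refine sum_le_sum fun j hj => ?_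
  have h1 : ((#P).choose j : ℝ) ≤ (#P : ℝ) ^ j := by exact_mod_cast Nat.choose_le_pow _ _
  have h2 : (1 : ℝ) ≤ r.choose j := by
    exact_mod_cast Nat.choose_pos (by simp at hj; omega)
  rw [mul_pow, one_pow, mul_one]
  calc k ^ j * ((#P).choose j : ℝ) ≤ k ^ j * (#P : ℝ) ^ j := by gcongr
    _ ≤ _ := le_mul_of_one_le_right (by positivity) h2

/-! ### Counting residue classes and sifting translates -/

/-- Chinese remainder theorem as multiplicativity of counts of residues. -/
theorem card_filter_range_mul_of_coprime {m n : ℕ} (hm : 0 < m) (hn : 0 < n) (h : m.Coprime n)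
    (p q : ℕ → Prop) [DecidablePred p] [DecidablePred q]
    (hp : ∀ x, p (x % m) ↔ p x) (hq : ∀ x, q (x % n) ↔ q x) :
    #{x ∈ range (m * n) | p x ∧ q x} = #{x ∈ range m | p x} * #{x ∈ range n | q x} := by
  rw [← card_product]
  refine card_bij (fun x _ => (x % m, x % n)) ?_ ?_ ?_
  · intro x hx
    simp only [mem_filter, mem_range, mem_product] at hx ⊢
    exact ⟨⟨Nat.mod_lt _ hm, (hp x).2 hx.2.1⟩, ⟨Nat.mod_lt _ hn, (hq x).2 hx.2.2⟩⟩
  · intro x hx y hy hxy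
    simp only [mem_filter, mem_range, Prod.mk.injEq] at hx hy hxy
    exact Nat.ModEq.eq_of_lt_of_lt ((Nat.modEq_and_modEq_iff_modEq_mul h).1 hxy) hx.1 hy.1
  · rintro ⟨a, b⟩ hab
    simp only [mem_filter, mem_range, mem_product] at hab
    refine ⟨Nat.chineseRemainder h a b, ?_, ?_⟩
    · have h1 := (Nat.chineseRemainder h a b).2
      simp only [mem_filter, mem_range]
      refine ⟨Nat.chineseRemainder_lt_mul h a b hm.ne' hn.ne', ?_, ?_⟩
      · rw [← hp, h1.1, hp]; exact hab.1.2
      · rw [← hq, h1.2, hq]; exact hab.2.2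
    · have h1 := (Nat.chineseRemainder h a b).2
      have e1 : _ % m = a % m := h1.1
      have e2 : _ % n = b % n := h1.2
      rw [e1, e2, Nat.mod_eq_of_lt hab.1.1, Nat.mod_eq_of_lt hab.2.1]

theorem card_filter_range_prime {p : ℕ} (hp : p.Prime) (H : Finset ℕ)
    (hH : Set.InjOn (fun h : ℕ => (h : ZMod p)) H) :
    #{x ∈ range p | ∃ h ∈ H, p ∣ x + h} = #H := by
  have := Fact.mk hp
  symm
  refine card_bij (fun h _ => (-(h : ZMod p)).val) ?_ ?_ ?_
  · intro h hh
    simp only [mem_filter, mem_range]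
    refine ⟨ZMod.val_lt _, h, hh, ?_⟩
    rw [← ZMod.natCast_eq_zero_iff]
    simp
  · intro a ha b hb hab
    exact hH ha hb (neg_injective (ZMod.val_injective p hab))
  · intro x hx
    simp only [mem_filter, mem_range] at hx
    obtain ⟨hx, h, hh, hd⟩ := hx
    refine ⟨h, hh, ?_⟩
    rw [← ZMod.natCast_eq_zero_iff] at hd
    push_cast at hd
    rw [← eq_neg_iff_add_eq_zero.2 hd, ZMod.val_natCast, Nat.mod_eq_of_lt hx]

theorem dvd_mod_add_iff {p d : ℕ} (h : p ∣ d) (x a : ℕ) : p ∣ x % d + a ↔ p ∣ x + a := by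
  have : (x % d + a) ≡ x + a [MOD p] := ((Nat.mod_modEq x d).of_dvd h).add_right a
  rw [Nat.dvd_iff_mod_eq_zero, Nat.dvd_iff_mod_eq_zero, this]

/-- Each prime of `T` forbids exactly `#H` classes, because the elements of `H` stay distinct modulo
it; the Chinese remainder theorem multiplies these counts. -/
theorem card_filter_range_prod (T : Finset ℕ) (hT : ∀ p ∈ T, p.Prime) (H : Finset ℕ)
    (hH : ∀ p ∈ T, Set.InjOn (fun h : ℕ => (h : ZMod p)) H) :
    #{x ∈ range (∏ p ∈ T, p) | ∀ p ∈ T, ∃ h ∈ H, p ∣ x + h} = #H ^ #T := by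
  induction T using Finset.induction_on with
  | empty => simp
  | insert q T hq ih =>
    have hT' : ∀ p ∈ T, p.Prime := fun p hp => hT p (mem_insert_of_mem hp)
    have hqp := hT q (mem_insert_self _ _)
    rw [prod_insert hq, card_insert_of_notMem hq, pow_succ, mul_comm (#H ^ #T),
      ← ih hT' (fun p hp => hH p (mem_insert_of_mem hp)),
      ← card_filter_range_prime hqp H (hH q (mem_insert_self _ _)),
      ← card_filter_range_mul_of_coprime hqp.pos (prod_pos fun p hp => (hT' p hp).pos)]
    · simp
    · exact Nat.Coprime.prod_right fun p hp => (Nat.coprime_primes hqp (hT' p hp)).2 fun e =>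
        hq (e ▸ hp)
    · intro x; simp [dvd_mod_add_iff dvd_rfl]
    · intro x
      refine forall₂_congr fun p hp => ?_
      have hd : p ∣ ∏ p ∈ T, p := dvd_prod_of_mem _ hp
      simp [dvd_mod_add_iff hd]

theorem abs_card_filter_Ico_modEq_sub_le (a M d v : ℕ) (hd : 0 < d) :
    |(#{x ∈ Ico a (a + M) | x ≡ v [MOD d]} : ℝ) - (M : ℝ) / d| ≤ 1 := by
  have h := Nat.Ico_filter_modEq_card a (a + M) hd v
  have hd' : (0 : ℚ) < d := by exact_mod_cast hd
  have hle : (((a : ℕ) - v : ℚ) / d) ≤ (((a + M : ℕ) : ℚ) - v) / d := by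
    gcongr; simp
  rw [max_eq_left (sub_nonneg.2 (Int.ceil_le_ceil hle))] at h
  have e : (((a + M : ℕ) : ℚ) - v) / d = ((a : ℚ) - v) / d + M / d := by push_cast; ring
  have h1 := Int.le_ceil ((((a + M : ℕ) : ℚ) - v) / d)
  have h2 := Int.ceil_lt_add_one ((((a + M : ℕ) : ℚ) - v) / d)
  have h3 := Int.le_ceil (((a : ℚ) - v) / d)
  have h4 := Int.ceil_lt_add_one (((a : ℚ) - v) / d)
  have h' : (#{x ∈ Ico a (a + M) | x ≡ v [MOD d]} : ℚ) =
      (⌈(((a + M : ℕ) : ℚ) - v) / d⌉ : ℚ) - (⌈((a : ℚ) - v) / d⌉ : ℚ) := by exact_mod_cast h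
  have : |(#{x ∈ Ico a (a + M) | x ≡ v [MOD d]} : ℚ) - (M : ℚ) / d| ≤ 1 := by
    rw [h', abs_le]; constructor <;> linarith
  have h5 : ((|(#{x ∈ Ico a (a + M) | x ≡ v [MOD d]} : ℚ) - (M : ℚ) / d| : ℚ) : ℝ) ≤ (1 : ℚ) :=
    Rat.cast_le.2 this
  push_cast at h5
  exact h5

theorem abs_card_filter_Ico_sub_le (a M d : ℕ) (hd : 0 < d) (p : ℕ → Prop) [DecidablePred p]
    (hp : ∀ x, p (x % d) ↔ p x) :
    |(#{x ∈ Ico a (a + M) | p x} : ℝ) - M * (#{x ∈ range d | p x} / d)| ≤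
      #{x ∈ range d | p x} := by
  have h : #{x ∈ Ico a (a + M) | p x} =
      ∑ v ∈ range d with p v, #{x ∈ Ico a (a + M) | x ≡ v [MOD d]} := by
    rw [card_eq_sum_card_fiberwise (f := fun x => x % d) (t := {x ∈ range d | p x})]
    · refine sum_congr rfl fun v hv => ?_
      simp only [mem_filter, mem_range] at hv
      congr 1
      ext x
      simp only [mem_filter, Nat.ModEq, Nat.mod_eq_of_lt hv.1]
      refine ⟨fun h => ⟨h.1.1, h.2⟩, fun h => ⟨⟨h.1, ?_⟩, h.2⟩⟩
      rw [← hp, h.2]; exact hv.2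
    · intro x hx
      simp only [coe_filter, Set.mem_ofPred_eq, mem_range] at hx ⊢
      exact ⟨Nat.mod_lt _ hd, (hp x).2 hx.2⟩
  rw [h]
  push_cast
  have e : (M : ℝ) * (#{x ∈ range d | p x} / d) = ∑ v ∈ range d with p v, (M : ℝ) / d := by
    rw [sum_const, nsmul_eq_mul]; ring
  rw [e, ← sum_sub_distrib]
  refine (abs_sum_le_sum_abs _ _).trans ((sum_le_sum fun v _ =>
    abs_card_filter_Ico_modEq_sub_le a M d v hd).trans ?_)
  simp

/-- Brun's pure sieve for the translates `n + h`, `h ∈ H`. -/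
theorem card_sieved_translates_le (a M : ℕ) (P H : Finset ℕ) (hP : ∀ p ∈ P, p.Prime)
    (hH : ∀ p ∈ P, Set.InjOn (fun h : ℕ => (h : ZMod p)) H) {r : ℕ} (hr : Even r) :
    (#{n ∈ Ico a (a + M) | ∀ p ∈ P, ∀ h ∈ H, ¬ p ∣ n + h} : ℝ) ≤
      M * (∏ p ∈ P, (1 - (#H : ℝ) / p)
          + Real.exp (-r) * ∏ p ∈ P, (1 + Real.exp 1 * ((#H : ℝ) / p)))
        + (1 + #H * #P : ℝ) ^ r := by
  have h := brun_pure_sieve (Ico a (a + M)) P (fun p n => ∃ h ∈ H, p ∣ n + h) hr M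
    (Nat.cast_nonneg _) (fun p => (#H : ℝ) / p) (fun p _ => by positivity) (#H) ?_
  · refine le_trans (le_of_eq ?_) (h.trans (add_le_add_right
      (sum_pow_card_le P r (Nat.cast_nonneg _)) _))
    simp
  · intro T hT
    have := abs_card_filter_Ico_sub_le a M (∏ p ∈ T, p)
      (prod_pos fun p hp => (hP p (hT hp)).pos) (fun x => ∀ p ∈ T, ∃ h ∈ H, p ∣ x + h) ?_
    · rw [card_filter_range_prod T (fun p hp => hP p (hT hp)) H (fun p hp => hH p (hT hp))] at this
      rw [prod_div_distrib, prod_const]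
      push_cast at this
      exact this
    · intro x
      refine forall₂_congr fun p hp => ?_
      have hd : p ∣ ∏ p ∈ T, p := dvd_prod_of_mem _ hp
      simp [dvd_mod_add_iff hd]

/-! ### Mertens-type estimates -/

/-- In the block up to `2 ^ (J + 2)`, `log p ≥ (J + 1) log 2`, so Chebyshev's bound on `theta`
limits the block's contribution to `4 / (J + 1)`. -/
theorem sum_inv_primesLE_two_pow_le (J : ℕ) :
    ∑ p ∈ Nat.primesLE (2 ^ (J + 1)), (1 / p : ℝ) ≤ 1 + 4 * harmonic J := by
  induction J with
  | zero =>
    have : Nat.primesLE (2 ^ (0 + 1)) = {2} := by decide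
    rw [this]; norm_num
  | succ J ih =>
    have hsub : Nat.primesLE (2 ^ (J + 1)) ⊆ Nat.primesLE (2 ^ (J + 1 + 1)) := by
      intro p hp
      rw [Nat.mem_primesLE] at hp ⊢
      exact ⟨hp.1.trans (Nat.pow_le_pow_right two_pos (Nat.le_succ _)), hp.2⟩
    rw [← sum_sdiff hsub, harmonic_succ]
    push_cast
    have hl2 : 0 < Real.log 2 := Real.log_pos one_lt_two
    have hpos : 0 < (2 : ℝ) ^ (J + 1) * ((J + 1) * Real.log 2) := by positivity
    have h1 : ∑ p ∈ Nat.primesLE (2 ^ (J + 1 + 1)) \ Nat.primesLE (2 ^ (J + 1)), (1 / p : ℝ) ≤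
        4 * ((J : ℝ) + 1)⁻¹ := by
      calc _ ≤ ∑ p ∈ Nat.primesLE (2 ^ (J + 1 + 1)) \ Nat.primesLE (2 ^ (J + 1)),
            Real.log p / (2 ^ (J + 1) * ((J + 1) * Real.log 2)) := by
            refine sum_le_sum fun p hp => ?_
            simp only [mem_sdiff, Nat.mem_primesLE] at hp
            have hlt : 2 ^ (J + 1) ≤ p := by
              by_contra h; exact hp.2 ⟨by omega, hp.1.2⟩
            have hlt' : (2 : ℝ) ^ (J + 1) ≤ p := by exact_mod_cast hlt
            have hp0 : (0 : ℝ) < p := by exact_mod_cast hp.1.2.pos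
            rw [div_le_div_iff₀ hp0 hpos, one_mul, mul_comm]
            have : ((J : ℝ) + 1) * Real.log 2 ≤ Real.log p := by
              have := Real.log_le_log (by positivity) hlt'
              rw [Real.log_pow] at this; push_cast at this; exact this
            gcongr
        _ ≤ ∑ p ∈ Nat.primesLE (2 ^ (J + 1 + 1)),
            Real.log p / (2 ^ (J + 1) * ((J + 1) * Real.log 2)) := by
            refine sum_le_sum_of_subset_of_nonneg sdiff_subset fun p hp _ => ?_
            exact div_nonneg (Real.log_natCast_nonneg p) hpos.le
        _ = Chebyshev.theta ((2 ^ (J + 1 + 1) : ℕ) : ℝ) / (2 ^ (J + 1) * ((J + 1) * Real.log 2)) := by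
            rw [← sum_div, Chebyshev.theta_eq_sum_primesLE_log]
        _ ≤ (Real.log 4 * (2 ^ (J + 1 + 1) : ℕ)) / (2 ^ (J + 1) * ((J + 1) * Real.log 2)) := by
            gcongr
            exact Chebyshev.theta_le_log4_mul_x (Nat.cast_nonneg _)
        _ = 4 * ((J : ℝ) + 1)⁻¹ := by
            have : Real.log 4 = 2 * Real.log 2 := by
              rw [show (4 : ℝ) = 2 ^ 2 by norm_num, Real.log_pow]; norm_num
            rw [this]; push_cast
            field_simp
            ring
    linarith

theorem sum_inv_primesLE_le {y : ℝ} (hy : 3 ≤ y) :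
    ∑ p ∈ Nat.primesLE ⌊y⌋₊, (1 / p : ℝ) ≤ 9 + 4 * Real.log (Real.log y) := by
  have hl2 : 0 < Real.log 2 := Real.log_pos one_lt_two
  have hl2' := Real.log_two_gt_d9
  have hly : 1 ≤ Real.log y := by
    rw [Real.le_log_iff_exp_le (by linarith)]
    linarith [Real.exp_one_lt_three]
  set J := ⌊Real.log y / Real.log 2⌋₊ with hJ
  have hJ1 : 1 ≤ J := by
    rw [hJ, Nat.one_le_floor_iff, one_le_div hl2]
    exact Real.log_le_log two_pos (by linarith)
  have hJ2 : (J : ℝ) ≤ Real.log y / Real.log 2 := Nat.floor_le (by positivity)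
  have hJ3 : Real.log y / Real.log 2 < J + 1 := Nat.lt_floor_add_one _
  have hJ0 : (0 : ℝ) < J := by exact_mod_cast hJ1
  have hle : ⌊y⌋₊ ≤ 2 ^ (J + 1) := by
    have : y ≤ (2 : ℝ) ^ (J + 1) := by
      rw [← Real.log_le_log_iff (by linarith) (by positivity), Real.log_pow]
      rw [div_lt_iff₀ hl2] at hJ3
      push_cast; exact hJ3.le
    exact_mod_cast (Nat.floor_le (by linarith)).trans this
  have h1 : ∑ p ∈ Nat.primesLE ⌊y⌋₊, (1 / p : ℝ) ≤
      ∑ p ∈ Nat.primesLE (2 ^ (J + 1)), (1 / p : ℝ) := by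
    refine sum_le_sum_of_subset_of_nonneg (fun p hp => ?_) fun p _ _ => by positivity
    rw [Nat.mem_primesLE] at hp ⊢
    exact ⟨hp.1.trans hle, hp.2⟩
  have h2 := sum_inv_primesLE_two_pow_le J
  have h3 := harmonic_le_one_add_log J
  have h4 : Real.log J ≤ 1 + Real.log (Real.log y) := by
    have : (J : ℝ) ≤ Real.exp 1 * Real.log y := by
      refine hJ2.trans ?_
      rw [div_le_iff₀ hl2]
      have h := Real.exp_one_gt_d9
      have : 1 ≤ Real.exp 1 * Real.log 2 := by nlinarith
      nlinarith
    have := Real.log_le_log hJ0 this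
    rwa [Real.log_mul (Real.exp_pos _).ne' (by positivity), Real.log_exp] at this
  linarith

/-- The inverse product expands as the sum of `1 / n` over smooth `n`, which include every positive
`n ≤ y`; it therefore dominates a harmonic sum. -/
theorem prod_one_sub_inv_primesLE_le {y : ℝ} (hy : 1 < y) :
    ∏ p ∈ Nat.primesLE ⌊y⌋₊, (1 - 1 / p : ℝ) ≤ 1 / Real.log y := by
  have hly : 0 < Real.log y := Real.log_pos hy
  set N := ⌊y⌋₊
  let f : ℕ →* ℝ := (invMonoidWithZeroHom : ℝ →*₀ ℝ).toMonoidHom.comp (Nat.castRingHom ℝ).toMonoidHom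
  have hf : ∀ n : ℕ, f n = (n : ℝ)⁻¹ := fun n => rfl
  have hs := (EulerProduct.summable_and_hasSum_smoothNumbers_prod_primesBelow_geometric (f := f)
    (fun {p} hp => by
      rw [hf, norm_inv, Real.norm_natCast]
      exact inv_lt_one_of_one_lt₀ (by exact_mod_cast hp.one_lt)) (N + 1)).2
  have h1 : (harmonic N : ℝ) ≤ ∏ p ∈ (N + 1).primesBelow, (1 - f p)⁻¹ := by
    have hmem : ∀ n ∈ Icc 1 N, n ∈ (N + 1).smoothNumbers := fun n hn => by
      rw [mem_Icc] at hn
      exact Nat.mem_smoothNumbers_of_lt (by omega) (by omega)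
    have := sum_le_hasSum ((Icc 1 N).subtype (· ∈ (N + 1).smoothNumbers))
      (fun i _ => by rw [hf]; positivity) hs
    rw [sum_subtype_eq_sum_filter (f := f), filter_true_of_mem hmem] at this
    rw [harmonic_eq_sum_Icc]
    push_cast
    exact this
  have h2 : Real.log y ≤ harmonic N := log_le_harmonic_floor y (by linarith)
  rw [prod_inv_distrib] at h1
  have h3 : (0 : ℝ) < ∏ p ∈ (N + 1).primesBelow, (1 - f p) := by
    refine prod_pos fun p hp => ?_
    rw [hf, sub_pos]
    exact inv_lt_one_of_one_lt₀ (by exact_mod_cast (Nat.prime_of_mem_primesBelow hp).one_lt)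
  have h4 : ∏ p ∈ Nat.primesLE N, (1 - 1 / p : ℝ) = ∏ p ∈ (N + 1).primesBelow, (1 - f p) := by
    simp only [hf, one_div]; rfl
  rw [h4, le_one_div h3 hly, one_div]
  exact h2.trans h1

theorem card_primeFactors_le_log {D : ℕ} (hD : D ≠ 0) :
    (#D.primeFactors : ℝ) ≤ Real.log D / Real.log 2 := by
  have h : 2 ^ #D.primeFactors ≤ D := by
    refine le_trans ?_ (Nat.le_of_dvd (Nat.pos_of_ne_zero hD) (Nat.prod_primeFactors_dvd D))
    exact pow_card_le_prod _ _ _ fun p hp => (Nat.prime_of_mem_primeFactors hp).two_le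
  rw [le_div_iff₀ (Real.log_pos one_lt_two), ← Real.log_pow]
  exact Real.log_le_log (by positivity) (by exact_mod_cast h)

/-- Prime factors up to `w` are bounded by the sum over all primes; the others number at most `log D
/ log 2`, each contributing at most `1 / w`. -/
theorem sum_inv_primeFactors_le {D : ℕ} (hD : D ≠ 0) {w : ℝ} (hw : 3 ≤ w) :
    ∑ p ∈ D.primeFactors, (1 / p : ℝ) ≤
      9 + 4 * Real.log (Real.log w) + Real.log D / Real.log 2 / w := by
  rw [← sum_filter_add_sum_filter_not D.primeFactors (fun p => p ≤ ⌊w⌋₊)]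
  refine add_le_add ?_ ?_
  · refine le_trans ?_ (sum_inv_primesLE_le hw)
    refine sum_le_sum_of_subset_of_nonneg (fun p hp => ?_) fun p _ _ => by positivity
    rw [mem_filter] at hp
    exact Nat.mem_primesLE.2 ⟨hp.2, Nat.prime_of_mem_primeFactors hp.1⟩
  · calc _ ≤ ∑ p ∈ D.primeFactors with ¬ p ≤ ⌊w⌋₊, 1 / w := by
          refine sum_le_sum fun p hp => ?_
          rw [mem_filter, not_le, Nat.floor_lt (by linarith)] at hp
          exact one_div_le_one_div_of_le (by linarith) hp.2.le
      _ ≤ ∑ p ∈ D.primeFactors, 1 / w :=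
          sum_le_sum_of_subset_of_nonneg (filter_subset _ _) fun p _ _ => by positivity
      _ ≤ _ := by
          rw [sum_const, nsmul_eq_mul, mul_one_div]
          gcongr
          exact card_primeFactors_le_log hD

theorem one_le_exp_mul_one_sub_inv {p : ℕ} (hp : p.Prime) :
    1 ≤ Real.exp (2 * (1 / p)) * (1 - 1 / p : ℝ) := by
  have h2 : (2 : ℝ) ≤ p := by exact_mod_cast hp.two_le
  have h3 : (1 / p : ℝ) ≤ 1 / 2 := one_div_le_one_div_of_le two_pos h2
  have h4 : (0 : ℝ) ≤ 1 / p := by positivity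
  have h5 := Real.add_one_le_exp (2 * (1 / p : ℝ))
  nlinarith

/-- Bernoulli gives `1 - k/p ≤ (1 - 1/p)^k`, the left side being nonnegative since primes `p ≤ k`
divide `D`. Restoring the primes dividing `D` costs the exponential factor. -/
theorem prod_one_sub_div_le {D k : ℕ} (hD : D ≠ 0) (hkD : ∀ p : ℕ, p.Prime → p ≤ k → p ∣ D)
    {y : ℝ} (hy : 1 < y) :
    ∏ p ∈ Nat.primesLE ⌊y⌋₊ with ¬ p ∣ D, (1 - k / p : ℝ) ≤
      (Real.exp (2 * ∑ p ∈ D.primeFactors, (1 / p : ℝ)) / Real.log y) ^ k := by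
  have hpos : ∀ p : ℕ, p.Prime → (0 : ℝ) < 1 - 1 / p := fun p hp => by
    rw [sub_pos, one_div]
    exact inv_lt_one_of_one_lt₀ (by exact_mod_cast hp.one_lt)
  have h1 : ∏ p ∈ Nat.primesLE ⌊y⌋₊ with ¬ p ∣ D, (1 - k / p : ℝ) ≤
      (∏ p ∈ Nat.primesLE ⌊y⌋₊ with ¬ p ∣ D, (1 - 1 / p : ℝ)) ^ k := by
    rw [← prod_pow]
    refine prod_le_prod (fun p hp => ?_) fun p hp => ?_
    all_goals
      rw [mem_filter, Nat.mem_primesLE] at hp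
      have hp0 : (0 : ℝ) < p := by exact_mod_cast hp.1.2.pos
    · rw [sub_nonneg, div_le_one hp0]
      by_contra h
      exact hp.2 (hkD p hp.1.2 (by exact_mod_cast (not_le.1 h).le))
    · have := one_add_mul_le_pow (a := -(1 / p : ℝ))
        (by have := hpos p hp.1.2; linarith) k
      calc (1 - k / p : ℝ) = 1 + k * (-(1 / p)) := by ring
        _ ≤ _ := this
        _ = _ := by ring
  refine h1.trans ?_
  have hnn : (0 : ℝ) ≤ ∏ p ∈ Nat.primesLE ⌊y⌋₊ with ¬ p ∣ D, (1 - 1 / p : ℝ) :=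
    prod_nonneg fun p hp => (hpos p (Nat.mem_primesLE.1 (mem_filter.1 hp).1).2).le
  refine pow_le_pow_left₀ hnn ?_ k
  have h2 : 1 ≤ Real.exp (2 * ∑ p ∈ D.primeFactors, (1 / p : ℝ)) *
      ∏ p ∈ Nat.primesLE ⌊y⌋₊ with p ∣ D, (1 - 1 / p : ℝ) := by
    have h3 : ∑ p ∈ Nat.primesLE ⌊y⌋₊ with p ∣ D, (1 / p : ℝ) ≤
        ∑ p ∈ D.primeFactors, (1 / p : ℝ) := by
      refine sum_le_sum_of_subset_of_nonneg (fun p hp => ?_) fun p _ _ => by positivity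
      rw [mem_filter, Nat.mem_primesLE] at hp
      exact Nat.mem_primeFactors.2 ⟨hp.1.2, hp.2, hD⟩
    calc (1 : ℝ) = ∏ _p ∈ Nat.primesLE ⌊y⌋₊ with _p ∣ D, 1 := prod_const_one.symm
      _ ≤ ∏ p ∈ Nat.primesLE ⌊y⌋₊ with p ∣ D,
          (Real.exp (2 * (1 / p)) * (1 - 1 / p : ℝ)) := by
          refine prod_le_prod (fun _ _ => zero_le_one) fun p hp => ?_
          exact one_le_exp_mul_one_sub_inv (Nat.mem_primesLE.1 (mem_filter.1 hp).1).2
      _ = Real.exp (2 * ∑ p ∈ Nat.primesLE ⌊y⌋₊ with p ∣ D, (1 / p : ℝ)) *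
          ∏ p ∈ Nat.primesLE ⌊y⌋₊ with p ∣ D, (1 - 1 / p : ℝ) := by
          rw [prod_mul_distrib, ← Real.exp_sum, mul_sum]
      _ ≤ _ := by
          gcongr
          exact prod_nonneg fun p hp => (hpos p (Nat.mem_primesLE.1 (mem_filter.1 hp).1).2).le
  have h4 := prod_one_sub_inv_primesLE_le hy
  rw [← prod_filter_mul_prod_filter_not _ (fun p => p ∣ D)] at h4
  calc _ ≤ (Real.exp (2 * ∑ p ∈ D.primeFactors, (1 / p : ℝ)) *
      ∏ p ∈ Nat.primesLE ⌊y⌋₊ with p ∣ D, (1 - 1 / p : ℝ)) *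
      ∏ p ∈ Nat.primesLE ⌊y⌋₊ with ¬ p ∣ D, (1 - 1 / p : ℝ) := le_mul_of_one_le_left hnn h2
    _ ≤ Real.exp (2 * ∑ p ∈ D.primeFactors, (1 / p : ℝ)) * (1 / Real.log y) := by
      rw [mul_assoc]; gcongr
    _ = _ := mul_one_div _ _

/-! ### The sieve bound for prime tuples: choice of parameters -/

/-- A nonzero number divisible by every prime `p ≤ #H` and by every prime modulo which two
elements of `H` coincide. -/
def tupleModulus (H : Finset ℕ) : ℕ := (#H).factorial * ∏ q ∈ H.offDiag, Nat.dist q.1 q.2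

theorem tupleModulus_ne_zero (H : Finset ℕ) : tupleModulus H ≠ 0 := by
  refine mul_ne_zero (Nat.factorial_ne_zero _) (prod_ne_zero_iff.2 fun q hq => ?_)
  exact (Nat.dist_pos_of_ne (mem_offDiag.1 hq).2.2).ne'

theorem injOn_natCast_of_not_dvd_tupleModulus {H : Finset ℕ} {p : ℕ}
    (hp : ¬ p ∣ tupleModulus H) : Set.InjOn (fun h : ℕ => (h : ZMod p)) H := by
  intro a ha b hb hab
  by_contra hne
  refine hp (Dvd.dvd.mul_left (Dvd.dvd.trans ?_ (dvd_prod_of_mem (fun q : ℕ × ℕ => Nat.dist q.1 q.2)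
    (mem_offDiag.2 ⟨ha, hb, hne⟩ : (a, b) ∈ H.offDiag))) _)
  have h : a ≡ b [MOD p] := (ZMod.natCast_eq_natCast_iff a b p).1 hab
  rcases le_total a b with hle | hle
  · simp only [Nat.dist_eq_sub_of_le hle]; exact (Nat.modEq_iff_dvd' hle).1 h
  · simp only [Nat.dist_eq_sub_of_le_right hle]; exact (Nat.modEq_iff_dvd' hle).1 h.symm

theorem log_tupleModulus_le {H : Finset ℕ} {Y : ℝ} (hY : 1 ≤ Y) (hH : ∀ h ∈ H, (h : ℝ) ≤ Y)
    (hf : ((#H).factorial : ℝ) ≤ Y) :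
    Real.log (tupleModulus H) ≤ ((#H : ℝ) ^ 2 + 1) * Real.log Y := by
  have h1 : (tupleModulus H : ℝ) ≤ Y ^ (#H ^ 2 + 1) := by
    rw [tupleModulus, pow_succ']
    push_cast
    refine mul_le_mul hf ?_ (prod_nonneg fun _ _ => Nat.cast_nonneg _) (by linarith)
    calc ∏ q ∈ H.offDiag, (Nat.dist q.1 q.2 : ℝ) ≤ ∏ q ∈ H.offDiag, Y := by
          refine prod_le_prod (fun _ _ => Nat.cast_nonneg _) fun q hq => ?_
          rw [mem_offDiag] at hq
          have : Nat.dist q.1 q.2 ≤ max q.1 q.2 := by unfold Nat.dist; omega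
          refine (Nat.cast_le.2 this).trans ?_
          rw [Nat.cast_max]
          exact max_le (hH _ hq.1) (hH _ hq.2.1)
      _ = Y ^ #H.offDiag := prod_const _
      _ ≤ Y ^ (#H ^ 2) := by
          refine pow_le_pow_right₀ hY ?_
          rw [offDiag_card, sq]; exact Nat.sub_le _ _
  have := Real.log_le_log (by exact_mod_cast Nat.pos_of_ne_zero (tupleModulus_ne_zero H)) h1
  rw [Real.log_pow] at this
  exact_mod_cast this

/-- The exponent `9 * k` is `k` times `8 + 1`: `8` from the primes dividing `D`, taking `w = L` in
`sum_inv_primeFactors_le`, and `1` from the `log L` in the sifting level. -/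
theorem sieve_main_term_le {k D : ℕ} (hD : D ≠ 0)
    (hkD : ∀ p : ℕ, p.Prime → p ≤ k → p ∣ D) {E L c : ℝ} (hc : 0 < c) (hL : 3 ≤ L)
    (hl : 0 < Real.log L) (hy : 0 < L / (c * Real.log L)) (hlogD : Real.log D ≤ E * L) :
    ∏ p ∈ Nat.primesLE ⌊Real.exp (L / (c * Real.log L))⌋₊ with ¬ p ∣ D, (1 - (k : ℝ) / p) ≤
      (Real.exp (2 * (9 + E / Real.log 2)) * c) ^ k * (Real.log L ^ (9 * k) / L ^ k) := by
  set l := Real.log L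
  have hL0 : 0 < L := by linarith
  have hl2 : 0 < Real.log 2 := Real.log_pos one_lt_two
  refine (prod_one_sub_div_le hD hkD (Real.one_lt_exp_iff.2 hy)).trans ?_
  have h2 : ∑ p ∈ D.primeFactors, (1 / p : ℝ) ≤ 9 + E / Real.log 2 + 4 * Real.log l := by
    refine (sum_inv_primeFactors_le hD hL).trans ?_
    have : Real.log D / Real.log 2 / L ≤ E / Real.log 2 := by
      rw [div_div, div_le_div_iff₀ (by positivity) hl2]
      nlinarith
    linarith
  have h3 : Real.exp (2 * ∑ p ∈ D.primeFactors, (1 / p : ℝ)) ≤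
      Real.exp (2 * (9 + E / Real.log 2)) * l ^ 8 := by
    rw [← Real.exp_log (pow_pos hl 8), ← Real.exp_add, Real.log_pow]
    refine Real.exp_le_exp.2 ?_
    push_cast; linarith
  rw [Real.log_exp]
  calc _ ≤ (Real.exp (2 * (9 + E / Real.log 2)) * l ^ 8 / (L / (c * l))) ^ k := by gcongr
    _ = _ := by
      rw [pow_mul l 9 k, ← div_pow, ← mul_pow]
      congr 1
      have : c ≠ 0 := by positivity
      field_simp

/-- The product is at most `exp (27 k + 12 k log L)`, so `r ≥ 13 k log L` leaves a saving of `exp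
(-k log L) = L ^ (-k)`. -/
theorem sieve_tail_le (k : ℕ) {L u : ℝ} (hL : 0 < L) (hl : 1 ≤ Real.log L) (hu : 2 ≤ u)
    (huL : u ≤ L) {P : Finset ℕ} (hP : P ⊆ Nat.primesLE ⌊Real.exp u⌋₊) {r : ℕ}
    (hr : 13 * k * Real.log L ≤ r) :
    Real.exp (-r) * ∏ p ∈ P, (1 + Real.exp 1 * ((k : ℝ) / p)) ≤
      Real.exp (27 * k) * (Real.log L ^ (9 * k) / L ^ k) := by
  set l := Real.log L with hldef
  have hy3 : 3 ≤ Real.exp u := by have := Real.add_one_le_exp u; linarith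
  have h1 : ∏ p ∈ P, (1 + Real.exp 1 * ((k : ℝ) / p)) ≤ Real.exp (27 * k + 12 * k * l) := by
    calc _ ≤ ∏ p ∈ P, Real.exp (Real.exp 1 * ((k : ℝ) / p)) := by
          refine prod_le_prod (fun p _ => by positivity) fun p _ => ?_
          rw [add_comm]; exact Real.add_one_le_exp _
      _ = Real.exp (∑ p ∈ P, Real.exp 1 * ((k : ℝ) / p)) := (Real.exp_sum _ _).symm
      _ ≤ _ := by
          refine Real.exp_le_exp.2 ?_
          have h2 : ∑ p ∈ P, (1 / p : ℝ) ≤ 9 + 4 * l := by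
            refine (sum_le_sum_of_subset_of_nonneg hP
              fun p _ _ => by positivity).trans ((sum_inv_primesLE_le hy3).trans ?_)
            rw [Real.log_exp]
            linarith [Real.log_le_log (by linarith) huL]
          have h3 : ∑ p ∈ P, Real.exp 1 * ((k : ℝ) / p) =
              Real.exp 1 * k * ∑ p ∈ P, (1 / p : ℝ) := by
            rw [mul_sum]; exact sum_congr rfl fun p _ => by ring
          rw [h3]
          calc _ ≤ 3 * k * (9 + 4 * l) := by
                gcongr
                exact Real.exp_one_lt_three.le
            _ = _ := by ring
  have h2 : Real.exp (-r) ≤ Real.exp (-(13 * k * l)) := Real.exp_le_exp.2 (neg_le_neg hr)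
  calc _ ≤ Real.exp (-(13 * k * l)) * Real.exp (27 * k + 12 * k * l) := by
        gcongr
    _ = Real.exp (27 * k) * (1 / L ^ k) := by
        have h4 : L ^ k = Real.exp (k * l) := by rw [Real.exp_nat_mul, hldef, Real.exp_log hL]
        rw [h4, one_div, ← Real.exp_neg, ← Real.exp_add, ← Real.exp_add]
        ring_nf
    _ ≤ _ := by
        gcongr
        exact one_le_pow₀ hl

/-- With `u` the logarithm of the sifting level, the remainder is at most `exp (2 r u)`. The value
of `c` is four times `26 k + 2`, exactly what makes this at most the square root of `X`. -/
theorem sieve_remainder_le {k : ℕ} {X c : ℝ} (hc : c = 104 * k + 8) (hX : 0 < X)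
    (hL : 0 < Real.log X) (hl : 1 ≤ Real.log (Real.log X))
    (hu : (k + 2 : ℝ) ≤ Real.log X / (c * Real.log (Real.log X)))
    (hLp : Real.log X ^ k ≤ Real.exp (Real.log X / 2)) {P : Finset ℕ}
    (hP : P ⊆ Nat.primesLE ⌊Real.exp (Real.log X / (c * Real.log (Real.log X)))⌋₊) {r : ℕ}
    (hr : (r : ℝ) ≤ (26 * k + 2) * Real.log (Real.log X)) :
    (1 + (k : ℝ) * #P) ^ r ≤ X * (Real.log (Real.log X) ^ (9 * k) / Real.log X ^ k) := by
  set L := Real.log X with hLdef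
  set l := Real.log L
  set u := L / (c * l) with hudef
  have hk0 : (0 : ℝ) ≤ k := Nat.cast_nonneg _
  have hc0 : c ≠ 0 := by rw [hc]; positivity
  have hyk := Real.add_one_le_exp u
  have h1 : (#P : ℝ) ≤ Real.exp u := by
    have h2 : #P ≤ ⌊Real.exp u⌋₊ := by
      refine (card_le_card hP).trans ?_
      rw [Nat.primesLE_eq_filter_Ioc_zero]
      exact (card_filter_le _ _).trans (by simp)
    exact (Nat.cast_le.2 h2).trans (Nat.floor_le (Real.exp_pos u).le)
  have h2 : 1 + (k : ℝ) * #P ≤ Real.exp u ^ 2 := by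
    have : (k : ℝ) * #P ≤ k * Real.exp u := by gcongr
    nlinarith
  calc (1 + (k : ℝ) * #P) ^ r ≤ (Real.exp u ^ 2) ^ r := by gcongr
    _ = Real.exp (r * (2 * u)) := by
        rw [← Real.exp_nat_mul, ← Real.exp_nat_mul]; norm_num
    _ ≤ Real.exp (L / 2) := by
        refine Real.exp_le_exp.2 ?_
        calc r * (2 * u) ≤ ((26 * k + 2) * l) * (2 * u) := by
              have : 0 ≤ u := by linarith
              gcongr
          _ = (52 * k + 4) * (c * l * u) / c := by field_simp; ring
          _ = (52 * k + 4) * L / c := by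
              rw [hudef, mul_div_cancel₀ L (mul_ne_zero hc0 (by positivity))]
          _ = L / 2 := by
              rw [div_eq_div_iff hc0 two_ne_zero, hc]; ring
    _ ≤ X * (1 / L ^ k) := by
        rw [mul_one_div, le_div_iff₀ (by positivity)]
        calc _ ≤ Real.exp (L / 2) * Real.exp (L / 2) := by gcongr
          _ = X := by rw [← Real.exp_add, add_halves, hLdef, Real.exp_log hX]
    _ ≤ _ := by
        gcongr
        exact one_le_pow₀ hl

theorem card_prime_translates_le_of_large {k : ℕ} {X B c : ℝ} (hc : c = 104 * k + 8)
    (hX : 1 ≤ X) (hB1 : 1 ≤ B) (hB : B ≤ X) (hk : (k.factorial : ℝ) ≤ X)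
    (hL : 3 ≤ Real.log X) (hl : 1 ≤ Real.log (Real.log X))
    (hu : (k + 2 : ℝ) ≤ Real.log X / (c * Real.log (Real.log X)))
    (hLp : Real.log X ^ k ≤ Real.exp (Real.log X / 2))
    {H : Finset ℕ} (hH : #H = k) (hHB : ∀ h ∈ H, (h : ℝ) ≤ B * X) :
    (#{n ∈ Ico ⌈X⌉₊ (⌈X⌉₊ + (⌊X⌋₊ + 1)) | ∀ h ∈ H, (n + h).Prime} : ℝ) ≤
      (2 * (Real.exp (2 * (9 + (2 * ((k : ℝ) ^ 2 + 1)) / Real.log 2)) * c) ^ k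
        + 2 * Real.exp (27 * k) + 1) *
      (X * (Real.log (Real.log X) ^ (9 * k) / Real.log X ^ k)) := by
  have hX0 : 0 < X := by linarith
  have hk0 : (0 : ℝ) ≤ k := Nat.cast_nonneg _
  have hc8 : 8 ≤ c := by rw [hc]; linarith
  have hlogD : Real.log (tupleModulus H) ≤ (2 * ((k : ℝ) ^ 2 + 1)) * Real.log X := by
    have h1 : 1 ≤ B * X := by nlinarith
    have := log_tupleModulus_le h1 hHB (by rw [hH]; nlinarith)
    rw [hH] at this
    refine this.trans ?_
    have h2 : Real.log (B * X) ≤ 2 * Real.log X := by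
      rw [Real.log_mul (by positivity) hX0.ne']
      linarith [Real.log_le_log (by linarith) hB]
    calc _ ≤ ((k : ℝ) ^ 2 + 1) * (2 * Real.log X) := by gcongr
      _ = _ := by ring
  set L := Real.log X with hLdef
  set l := Real.log L
  have hL0 : 0 < L := by linarith
  have huL : L / (c * l) < L := div_lt_self hL0 (by nlinarith)
  have hyX : Real.exp (L / (c * l)) < X := by
    rwa [← Real.lt_log_iff_exp_lt hX0]
  set P := {p ∈ Nat.primesLE ⌊Real.exp (L / (c * l))⌋₊ | ¬ p ∣ tupleModulus H} with hP
  set r := 2 * ⌈13 * k * l⌉₊ with hr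
  have hPp : ∀ p ∈ P, p.Prime := fun p hp => (Nat.mem_primesLE.1 (mem_filter.1 hp).1).2
  -- A sifting prime dividing the prime `n + h` would equal it, but `n + h ≥ X` exceeds the sifting
  -- level.
  have hsub : {n ∈ Ico ⌈X⌉₊ (⌈X⌉₊ + (⌊X⌋₊ + 1)) | ∀ h ∈ H, (n + h).Prime} ⊆
      {n ∈ Ico ⌈X⌉₊ (⌈X⌉₊ + (⌊X⌋₊ + 1)) | ∀ p ∈ P, ∀ h ∈ H, ¬ p ∣ n + h} := by
    intro n hn
    rw [mem_filter] at hn ⊢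
    refine ⟨hn.1, fun p hp h hh hd => ?_⟩
    have h1 := (Nat.prime_dvd_prime_iff_eq (hPp p hp) (hn.2 h hh)).1 hd
    have h2 : (p : ℝ) ≤ Real.exp (L / (c * l)) :=
      (Nat.le_floor_iff (Real.exp_pos _).le).1 (Nat.mem_primesLE.1 (mem_filter.1 hp).1).1
    have h3 : X ≤ n := Nat.ceil_le.1 (mem_Ico.1 hn.1).1
    have h4 : (n : ℝ) ≤ p := by exact_mod_cast h1 ▸ Nat.le_add_right n h
    linarith
  have hmain := card_sieved_translates_le ⌈X⌉₊ (⌊X⌋₊ + 1) P H hPp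
    (fun p hp => injOn_natCast_of_not_dvd_tupleModulus (mem_filter.1 hp).2) (r := r)
    (even_two_mul _)
  rw [hH] at hmain
  have hM : ((⌊X⌋₊ + 1 : ℕ) : ℝ) ≤ 2 * X := by
    push_cast; linarith [Nat.floor_le hX0.le]
  have h13 : (0 : ℝ) ≤ 13 * k * l := by positivity
  have hT1 := sieve_main_term_le (k := k) (tupleModulus_ne_zero H)
    (fun p hp hpk => Dvd.dvd.mul_right ((hp.dvd_factorial).2 (hH ▸ hpk)) _) (c := c)
    (by linarith) hL (by linarith) (by linarith) hlogD
  have hT2 := sieve_tail_le k hL0 hl (by linarith) huL.le (P := P) (filter_subset _ _) (r := r) (by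
    have := Nat.le_ceil (13 * k * l)
    rw [hr]; push_cast; linarith)
  have hT3 := sieve_remainder_le hc hX0 hL0 hl hu hLp (P := P) (filter_subset _ _) (r := r) (by
    have := Nat.ceil_lt_add_one h13
    rw [hr]; push_cast; nlinarith)
  set Z := l ^ (9 * k) / L ^ k
  have hZ0 : 0 ≤ Z := by positivity
  refine (Nat.cast_le.2 (card_le_card hsub)).trans (hmain.trans ?_)
  set E := (Real.exp (2 * (9 + (2 * ((k : ℝ) ^ 2 + 1)) / Real.log 2)) * c) ^ k
  have hE : 0 ≤ E := by positivity
  refine (add_le_add ((mul_le_mul_of_nonneg_left (add_le_add hT1 hT2) (Nat.cast_nonneg _)).trans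
    (mul_le_mul_of_nonneg_right hM (by positivity))) hT3).trans (le_of_eq ?_)
  ring

open Filter Asymptotics in
/-- Upper bound sieve for prime tuples, up to a power of `log log X`. -/
theorem exists_card_prime_translates_le (k : ℕ) {B : ℝ} (hB : 1 ≤ B) :
    ∃ C : ℝ, 0 < C ∧ ∀ᶠ X : ℝ in atTop, ∀ H : Finset ℕ, #H = k → (∀ h ∈ H, (h : ℝ) ≤ B * X) →
      (#{n ∈ Ico ⌈X⌉₊ (⌈X⌉₊ + (⌊X⌋₊ + 1)) | ∀ h ∈ H, (n + h).Prime} : ℝ) ≤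
        C * (X * (Real.log (Real.log X) ^ (9 * k) / Real.log X ^ k)) := by
  refine ⟨2 * (Real.exp (2 * (9 + (2 * ((k : ℝ) ^ 2 + 1)) / Real.log 2)) * (104 * k + 8)) ^ k
    + 2 * Real.exp (27 * k) + 1, by positivity, ?_⟩
  have hlog := Real.tendsto_log_atTop
  have e1 : ∀ᶠ L : ℝ in atTop, (k + 2 : ℝ) ≤ L / ((104 * k + 8) * Real.log L) := by
    have h2 := Real.isLittleO_log_id_atTop.bound
      (c := 1 / ((k + 2) * (104 * k + 8) : ℝ)) (by positivity)
    filter_upwards [h2, eventually_gt_atTop 1] with L h2 h3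
    have h4 := Real.log_pos h3
    rw [Real.norm_of_nonneg h4.le, id, Real.norm_of_nonneg (by linarith), one_div_mul_eq_div,
      le_div_iff₀ (by positivity)] at h2
    rw [le_div_iff₀ (by positivity)]
    linarith
  have e2 : ∀ᶠ L : ℝ in atTop, L ^ k ≤ Real.exp (L / 2) := by
    have := (isLittleO_pow_exp_pos_mul_atTop k (b := 1 / 2) (by norm_num)).bound one_pos
    filter_upwards [this, eventually_ge_atTop 0] with L h h0
    rw [Real.norm_of_nonneg (by positivity), Real.norm_of_nonneg (Real.exp_pos _).le, one_mul] at h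
    rwa [div_eq_inv_mul, ← one_div]
  filter_upwards [eventually_ge_atTop 1, eventually_ge_atTop B,
    eventually_ge_atTop (k.factorial : ℝ), hlog.eventually_ge_atTop 3,
    (hlog.comp hlog).eventually_ge_atTop 1, hlog.eventually e1, hlog.eventually e2]
    with X h1 h2 h3 h4 h5 h6 h7 H hH hHB
  exact card_prime_translates_le_of_large rfl h1 hB h2 h3 h4 h5 h6 h7 hH hHB

/-! ### Chebyshev lower bound for primes in a dyadic interval -/

/-- Chebyshev's argument, keeping track of the primes in `(n, 2n]`. -/
theorem centralBinom_le_mul_pow_card_primes (n : ℕ) (hn : 2 < n) :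
    n.centralBinom ≤ (2 * n) ^ Nat.sqrt (2 * n) * 4 ^ (2 * n / 3) *
      (2 * n) ^ #{p ∈ Ioc n (2 * n) | p.Prime} := by
  have n_pos : 0 < n := by omega
  have n2_pos : 1 ≤ 2 * n := by omega
  set f : ℕ → ℕ := fun x => x ^ n.centralBinom.factorization x with hf
  set S := {p ∈ range (2 * n + 1) | p.Prime} with hS
  have h0 : n.centralBinom = ∏ p ∈ S, f p := by
    rw [← Nat.prod_pow_factorization_centralBinom, hS, prod_filter_of_ne]
    intro p _ h
    contrapose h
    rw [hf]
    simp [Nat.factorization_eq_zero_of_not_prime _ h]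
  have hfle : ∀ p, f p ≤ 2 * n := fun p => Nat.pow_factorization_choose_le (by omega)
  -- As in Erdős's proof of Bertrand's postulate: prime powers are at most `2 * n`, exponents are at
  -- most `1` beyond the square root, and vanish for `2n/3 < p ≤ n`.
  rw [h0, ← prod_filter_mul_prod_filter_not S (· ≤ n)]
  refine Nat.mul_le_mul ?_ ?_
  · rw [← prod_filter_mul_prod_filter_not _ (· ≤ Nat.sqrt (2 * n))]
    refine Nat.mul_le_mul ?_ ?_
    · refine (prod_le_prod' fun p _ => hfle p).trans ?_
      rw [prod_const]
      refine Nat.pow_le_pow_right n2_pos ?_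
      calc _ ≤ #(Icc 1 (Nat.sqrt (2 * n))) := card_le_card fun p hp => by
            simp only [hS, mem_filter, mem_range] at hp
            exact mem_Icc.2 ⟨hp.1.1.2.one_lt.le, hp.2⟩
        _ = _ := by simp
    · refine le_trans ?_ (primorial_le_four_pow (2 * n / 3))
      set U := {p ∈ {p ∈ S | p ≤ n} | ¬ p ≤ Nat.sqrt (2 * n)} with hU
      have hmem : ∀ p ∈ U, p.Prime ∧ p ≤ n ∧ Nat.sqrt (2 * n) < p := fun p hp => by
        simp only [hU, hS, mem_filter, mem_range, not_le] at hp
        exact ⟨hp.1.1.2, hp.1.2, hp.2⟩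
      calc ∏ p ∈ U, f p = ∏ p ∈ U with p ≤ 2 * n / 3, f p := by
            refine (prod_filter_of_ne fun p hp h => ?_).symm
            contrapose! h
            have := hmem p hp
            have h3 : 2 * n < 3 * p := by omega
            simp [hf, Nat.factorization_centralBinom_of_two_mul_self_lt_three_mul hn this.2.1 h3]
        _ ≤ ∏ p ∈ U with p ≤ 2 * n / 3, p := by
            refine prod_le_prod' fun p hp => ?_
            have := hmem p (mem_filter.1 hp).1
            refine (Nat.pow_le_pow_right this.1.pos ?_).trans (pow_one p).le
            exact Nat.factorization_choose_le_one (Nat.sqrt_lt'.1 this.2.2)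
        _ ≤ primorial (2 * n / 3) := by
            rw [primorial_eq_prod_primesLE]
            refine prod_le_prod_of_subset_of_one_le' (fun p hp => ?_)
              fun p hp _ => (Nat.prime_of_mem_primesLE hp).one_lt.le
            rw [mem_filter] at hp
            exact Nat.mem_primesLE.2 ⟨hp.2, (hmem p hp.1).1⟩
  · refine (prod_le_prod' fun p _ => hfle p).trans ?_
    rw [prod_const]
    refine Nat.pow_le_pow_right n2_pos (card_le_card fun p hp => ?_)
    simp only [hS, mem_filter, mem_range, mem_Ioc] at hp ⊢
    exact ⟨⟨by omega, by omega⟩, hp.1.2⟩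

theorem log_two_mul_le_card_primes {n : ℕ} (hn : 4 ≤ n) :
    Real.log 2 / 3 * (2 * n) - 2 * (√(2 * n : ℝ) * Real.log (2 * n)) ≤
      #{p ∈ Ioc n (2 * n) | p.Prime} * Real.log (2 * n) := by
  set m := #{p ∈ Ioc n (2 * n) | p.Prime}
  have hn0 : (0 : ℝ) < n := by exact_mod_cast (by omega : 0 < n)
  have h1 : (4 : ℝ) ^ n ≤
      n * ((2 * n : ℝ) ^ Nat.sqrt (2 * n) * 4 ^ (2 * n / 3) * (2 * n : ℝ) ^ m) := by
    exact_mod_cast (Nat.four_pow_lt_mul_centralBinom n hn).le.trans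
      (Nat.mul_le_mul_left n (centralBinom_le_mul_pow_card_primes n (by omega)))
  have h2 := Real.log_le_log (by positivity) h1
  rw [Real.log_mul (by positivity) (by positivity), Real.log_mul (by positivity) (by positivity),
    Real.log_mul (by positivity) (by positivity), Real.log_pow, Real.log_pow, Real.log_pow,
    Real.log_pow] at h2
  have h4 : Real.log 4 = 2 * Real.log 2 := by
    rw [show (4 : ℝ) = 2 ^ 2 by norm_num, Real.log_pow]; norm_num
  have hl2 : 0 < Real.log 2 := Real.log_pos one_lt_two
  have hn4 : (4 : ℝ) ≤ n := by exact_mod_cast hn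
  have hl : 0 ≤ Real.log (2 * n) := Real.log_nonneg (by linarith)
  have h5 : ((2 * n / 3 : ℕ) : ℝ) * Real.log 4 ≤ 2 * n / 3 * Real.log 4 := by
    refine mul_le_mul_of_nonneg_right ?_ (by linarith)
    exact Nat.cast_div_le.trans (by push_cast; rfl)
  have h6 : (Nat.sqrt (2 * n) : ℝ) * Real.log (2 * n) ≤ √(2 * n : ℝ) * Real.log (2 * n) := by
    refine mul_le_mul_of_nonneg_right ?_ hl
    have := Real.nat_sqrt_le_real_sqrt (a := 2 * n)
    push_cast at this; exact this
  have h7 : Real.log n ≤ √(2 * n : ℝ) * Real.log (2 * n) := by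
    have h8 : Real.log n ≤ Real.log (2 * n) := Real.log_le_log hn0 (by linarith)
    have h9 : 1 ≤ √(2 * n : ℝ) := Real.one_le_sqrt.2 (by linarith)
    nlinarith
  rw [h4] at h2 h5
  linarith

theorem finite_dyadicPrimes (X : ℝ) : (dyadicPrimes X).Finite :=
  (Set.finite_Iic ⌊2 * X⌋₊).subset fun _ hp => Nat.le_floor hp.2.2

open Filter Asymptotics in
theorem eventually_le_ncard_dyadicPrimes :
    ∀ᶠ X : ℝ in atTop, X / (20 * Real.log X) ≤ (dyadicPrimes X).ncard := by
  have e1 : ∀ᶠ x : ℝ in atTop, √x * Real.log x ≤ 1 / 20 * x := by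
    have h := (isLittleO_log_rpow_atTop (r := 1 / 2) (by norm_num)).bound
      (c := 1 / 20) (by norm_num)
    filter_upwards [h, eventually_ge_atTop 1] with x h hx
    rw [← Real.sqrt_eq_rpow, Real.norm_of_nonneg (Real.log_nonneg hx),
      Real.norm_of_nonneg (Real.sqrt_nonneg x)] at h
    calc √x * Real.log x ≤ √x * (1 / 20 * √x) := by gcongr
      _ = 1 / 20 * (√x * √x) := by ring
      _ = _ := by rw [Real.mul_self_sqrt (by linarith)]
  have e2 : Tendsto (fun X : ℝ => 2 * (⌊X⌋₊ : ℝ)) atTop atTop :=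
    (tendsto_natCast_atTop_atTop.comp tendsto_nat_floor_atTop).const_mul_atTop two_pos
  filter_upwards [e2.eventually e1, eventually_ge_atTop 4] with X h1 hX
  set n := ⌊X⌋₊
  have hn1 : (n : ℝ) ≤ X := Nat.floor_le (by linarith)
  have hn2 : X < n + 1 := Nat.lt_floor_add_one X
  have hn4 : 4 ≤ n := Nat.le_floor (by exact_mod_cast hX)
  have h2 := log_two_mul_le_card_primes hn4
  have hl2 := Real.log_two_gt_d9
  have hlX : 0 < Real.log X := Real.log_pos (by linarith)
  have hm : #{p ∈ Ioc n (2 * n) | p.Prime} ≤ (dyadicPrimes X).ncard := by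
    rw [← Set.ncard_coe_finset]
    refine Set.ncard_le_ncard (fun p hp => ?_) (finite_dyadicPrimes X)
    simp only [coe_filter, mem_Ioc, Set.mem_ofPred_eq] at hp
    have h3 : (n : ℝ) + 1 ≤ p := by exact_mod_cast hp.1.1
    have h4 : (p : ℝ) ≤ 2 * n := by exact_mod_cast hp.1.2
    exact ⟨hp.2, by linarith, by linarith⟩
  have hm' : (#{p ∈ Ioc n (2 * n) | p.Prime} : ℝ) ≤ (dyadicPrimes X).ncard := by
    exact_mod_cast hm
  have hlog : Real.log (2 * n) ≤ 2 * Real.log X := by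
    have h3 : Real.log (2 * n) ≤ Real.log (X * X) :=
      Real.log_le_log (by linarith) (by nlinarith)
    rw [Real.log_mul (x := X) (by linarith) (by linarith)] at h3
    linarith
  rw [div_le_iff₀ (by positivity)]
  have h3 : (#{p ∈ Ioc n (2 * n) | p.Prime} : ℝ) * Real.log (2 * n) ≤
      (dyadicPrimes X).ncard * (2 * Real.log X) :=
    mul_le_mul hm' hlog (Real.log_nonneg (by linarith)) (Nat.cast_nonneg _)
  nlinarith

/-! ### Iterated next primes and gap vectors -/

theorem lt_nextPrime (n : ℕ) : n < nextPrime n := by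
  classical exact (Nat.find_spec (exists_prime_gt n)).1

theorem prime_nextPrime (n : ℕ) : (nextPrime n).Prime := by
  classical exact (Nat.find_spec (exists_prime_gt n)).2

theorem nextPrime_le_two_mul {n : ℕ} (hn : n ≠ 0) : nextPrime n ≤ 2 * n := by
  classical
  obtain ⟨p, hp, h1, h2⟩ := Nat.exists_prime_lt_and_le_two_mul n hn
  exact (Nat.find_min' (exists_prime_gt n) ⟨h1, hp⟩).trans h2

theorem add_gap (n : ℕ) : n + gap n = nextPrime n := Nat.add_sub_cancel' (lt_nextPrime n).le

theorem prime_iterate_nextPrime {p : ℕ} (hp : p.Prime) (j : ℕ) : (nextPrime^[j] p).Prime := by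
  cases j with
  | zero => exact hp
  | succ j => rw [Function.iterate_succ_apply']; exact prime_nextPrime _

theorem strictMono_iterate_nextPrime (p : ℕ) : StrictMono fun j => nextPrime^[j] p :=
  strictMono_nat_of_lt_succ fun j => by
    rw [Function.iterate_succ_apply']; exact lt_nextPrime _

theorem iterate_nextPrime_le {p : ℕ} (hp : p.Prime) (j : ℕ) : nextPrime^[j] p ≤ 2 ^ j * p := by
  induction j with
  | zero => simp
  | succ j ih =>
    rw [Function.iterate_succ_apply', pow_succ', mul_assoc]
    exact (nextPrime_le_two_mul (prime_iterate_nextPrime hp j).ne_zero).trans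
      (Nat.mul_le_mul_left 2 ih)

theorem iterate_nextPrime_add_eq {t p q : ℕ} (h : gapVector t p = gapVector t q) {j : ℕ}
    (hj : j ≤ t) : nextPrime^[j] p + q = nextPrime^[j] q + p := by
  induction j with
  | zero => simp [add_comm]
  | succ j ih =>
    have h1 : gap (nextPrime^[j] p) = gap (nextPrime^[j] q) := congrFun h ⟨j, hj⟩
    rw [Function.iterate_succ_apply', Function.iterate_succ_apply', ← add_gap, ← add_gap, h1]
    have := ih (by omega)
    omega

/-- The primes in `[X, 2X]` with a given gap vector give prime values of fixed translates. -/
theorem exists_translates_of_gapVector_eq {t : ℕ} {X : ℝ} (v : Fin t → ℕ)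
    (hv : ∃ p ∈ dyadicPrimes X, gapVector t p = v) :
    ∃ H : Finset ℕ, #H = t + 1 ∧ (∀ h ∈ H, (h : ℝ) ≤ 2 ^ (t + 1) * X) ∧
      ∀ p : ℕ, p.Prime → gapVector t p = v → ∀ h ∈ H, (p + h).Prime := by
  obtain ⟨q, hq, rfl⟩ := hv
  have hle : ∀ j, q ≤ nextPrime^[j] q := fun j =>
    (strictMono_iterate_nextPrime q).monotone (Nat.zero_le j)
  -- The offsets are read off from one witness `q`; any prime with the same gap vector has the same
  -- offsets.
  refine ⟨(range (t + 1)).image fun j => nextPrime^[j] q - q, ?_, ?_, ?_⟩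
  · rw [card_image_of_injective, card_range]
    intro i j hij
    refine (strictMono_iterate_nextPrime q).injective ?_
    have := hle i
    have := hle j
    simp only at hij ⊢
    omega
  · intro h hh
    obtain ⟨j, hj, rfl⟩ := mem_image.1 hh
    rw [mem_range] at hj
    have h1 : nextPrime^[j] q - q ≤ 2 ^ t * q := (Nat.sub_le _ _).trans
      ((iterate_nextPrime_le hq.1 j).trans
        (Nat.mul_le_mul_right _ (Nat.pow_le_pow_right two_pos (by omega))))
    have h2 : ((nextPrime^[j] q - q : ℕ) : ℝ) ≤ 2 ^ t * q := by exact_mod_cast h1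
    refine h2.trans ?_
    rw [pow_succ, mul_assoc]
    gcongr
    exact hq.2.2
  · intro p hp hpq h hh
    obtain ⟨j, hj, rfl⟩ := mem_image.1 hh
    have h1 := iterate_nextPrime_add_eq hpq (Nat.lt_succ_iff.1 (mem_range.1 hj))
    have := hle j
    rw [show p + (nextPrime^[j] q - q) = nextPrime^[j] p by omega]
    exact prime_iterate_nextPrime hp j

theorem gapVectorLaw_real_eq (t : ℕ) (X : ℝ) (S : Finset (Fin t → ℕ)) :
    (gapVectorLaw t X).real (S : Set (Fin t → ℕ)) =
      #{p ∈ (finite_dyadicPrimes X).toFinset | gapVector t p ∈ S} / (dyadicPrimes X).ncard := by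
  rw [gapVectorLaw, MeasureTheory.map_measureReal_apply Measurable.of_discrete S.measurableSet,
    MeasureTheory.measureReal_def,
    ← ProbabilityTheory.uniformOn_inter_self (finite_dyadicPrimes X)]
  set F := (finite_dyadicPrimes X).toFinset
  have h1 : dyadicPrimes X = (F : Set ℕ) := (Set.Finite.coe_toFinset _).symm
  have h2 : (F : Set ℕ) ∩ gapVector t ⁻¹' (S : Set (Fin t → ℕ)) =
      (({p ∈ F | gapVector t p ∈ S} : Finset ℕ) : Set ℕ) := by
    ext p; simp
  clear_value F
  rw [h1, h2, Set.ncard_coe_finset, ProbabilityTheory.uniformOn_apply_finset,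
    inter_eq_right.2 (filter_subset _ _)]
  simp

end PrimeGaps

/-! ### Conclusion -/

open PrimeGaps Finset in
theorem mainTheorem7 (t : ℕ) (ht : 1 ≤ t) :
    ∃ C : ℝ, 0 < C ∧ ∃ A : ℕ, ∃ X₀ : ℝ, ∀ X : ℝ, X₀ ≤ X → ∀ S : Finset (Fin t → ℕ),
      (PrimeGaps.gapVectorLaw t X).real (S : Set (Fin t → ℕ)) ≤
        C * ((S.card : ℝ) * Real.log (Real.log (3 * X)) ^ A / Real.log X ^ t) := by
  obtain ⟨C, hC, hsieve⟩ := exists_card_prime_translates_le (t + 1)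
    (B := 2 ^ (t + 1)) (one_le_pow₀ one_le_two)
  have hlog := Real.tendsto_log_atTop
  obtain ⟨X₀, hX₀⟩ := Filter.eventually_atTop.1 (hsieve.and (eventually_le_ncard_dyadicPrimes.and
    ((Filter.eventually_ge_atTop 1).and ((hlog.eventually_ge_atTop 1)))))
  refine ⟨20 * C, by positivity, 9 * (t + 1), X₀, fun X hX S => ?_⟩
  obtain ⟨h1, h2, hX1, hL⟩ := hX₀ X hX
  set L := Real.log X
  have hX0 : 0 < X := by linarith
  have hL0 : 0 < L := by linarith
  set Z := C * (X * (Real.log L ^ (9 * (t + 1)) / L ^ (t + 1))) with hZ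
  have hl0 : 0 ≤ Real.log L := Real.log_nonneg hL
  have hZ0 : 0 ≤ Z := by positivity
  have hv : ∀ v : Fin t → ℕ,
      (#{p ∈ (finite_dyadicPrimes X).toFinset | gapVector t p = v} : ℝ) ≤ Z := by
    intro v
    -- Only an attained `v` is known to have offsets of size `O(X)`, as the sieve bound requires;
    -- otherwise the count is zero.
    by_cases hne : ∃ p ∈ dyadicPrimes X, gapVector t p = v
    · obtain ⟨H, hH, hHB, hHp⟩ := exists_translates_of_gapVector_eq v hne
      refine le_trans (Nat.cast_le.2 (card_le_card fun p hp => ?_)) (h1 H hH hHB)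
      rw [mem_filter, Set.Finite.mem_toFinset] at hp
      rw [mem_filter, mem_Ico]
      refine ⟨⟨Nat.ceil_le.2 hp.1.2.1, ?_⟩, hHp p hp.1.1 hp.2⟩
      have h3 : (p : ℝ) < (⌈X⌉₊ + (⌊X⌋₊ + 1) : ℕ) := by
        push_cast
        linarith [hp.1.2.2, Nat.le_ceil X, Nat.lt_floor_add_one X]
      exact_mod_cast h3
    · rw [filter_false_of_mem]
      · simpa using hZ0
      · intro p hp h
        exact hne ⟨p, (Set.Finite.mem_toFinset _).1 hp, h⟩
  have hcard : (#{p ∈ (finite_dyadicPrimes X).toFinset | gapVector t p ∈ S} : ℝ) ≤ #S * Z := by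
    rw [card_eq_sum_card_fiberwise (f := gapVector t) (t := S) (fun p hp => by
      simpa using (mem_filter.1 (mem_coe.1 hp)).2)]
    push_cast
    rw [← nsmul_eq_mul, ← sum_const]
    refine sum_le_sum fun v _ => le_trans (Nat.cast_le.2 (card_le_card ?_)) (hv v)
    exact filter_subset_filter _ (filter_subset _ _)
  rw [gapVectorLaw_real_eq]
  -- The prime count in the denominator cancels `X` and one of the `t + 1` powers of `L`.
  calc _ ≤ (#S * Z) / (X / (20 * L)) := by gcongr
    _ = 20 * C * (#S * Real.log L ^ (9 * (t + 1)) / L ^ t) := by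
        rw [hZ, pow_succ L t]; field_simp
    _ ≤ _ := by
        have : L ≤ Real.log (3 * X) := Real.log_le_log hX0 (by linarith)
        gcongr
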